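/- Let $\mathcal{Y}=\{0,1\}$. A learning problem $(\mathcal{H},\mathcal{P})$ on a measurable space $\mathcal{X}$ consists of a set $\mathcal{H}$ of measurable classifiers $h:\mathcal{X}\to\mathcal{Y}$ and a set $\mathcal{P}$ of probability distributions on $\mathcal{X}\times\mathcal{Y}$. For $P\in\mathcal{P}$ with marginal $P_X$ on $\mathcal{X}$, write $R_P(f)=P(f(X)\neq Y)$ and $R_{P,\mathcal{H}}=\inf_{h\in\mathcal{H}}R_P(h)$. The minimax expected excess risk for $\ell$ labeled and $u$ unlabeled examples is $$L(\ell,u,\mathcal{H},\mathcal{P})=\inf_{A}\ \sup_{P\in\mathcal{P}}\ \mathbb{E}_{S\sim P^{\ell}\times P_X^{u}}\bigl[(R_P(A(S))-R_{P,\mathcal{H}})_+\bigr],$$ where $A$ ranges over all (measurable) maps $(\mathcal{X}\times\mathcal{Y})^{\ell}\times\mathcal{X}^{u}\to\mathcal{Y}^{\mathcal{X}}$. Write $f(\ell)\asymp g(\ell)$ if there are constants $c_1,c_2>0$ with $c_1g(\ell)\le f(\ell)\le c_2g(\ell)$ for all $\ell\ge 1$. Let $(\mathcal{H}_A,\mathcal{P}_A)$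 be the two-point problem: $\mathcal{X}_A=\{x_1,x_2\}$, $\mathcal{H}_A=\{0,1\}^{\mathcal{X}_A}$, and $\mathcal{P}_A$ is the set of all $P$ with $P_X(x_i)>0$ and $P(Y=1\mid X=x_i)=P_X(x_i)$ for $i=1,2$. For a hypothesis class $\mathcal{H}_B$ on a domain $\mathcal{X}_B$ disjoint from $\mathcal{X}_A$, let $\mathcal{P}_B$ be the set of all distributions $P$ on $\mathcal{X}_B\times\mathcal{Y}$ that are realizable, i.e. $R_P(h)=0$ for some $h\in\mathcal{H}_B$. The mixture problem on $\mathcal{X}_A\cup\mathcal{X}_B$ is $$\mathcal{H}=\{h:\ h|_{\mathcal{X}_A}\in\mathcal{H}_A,\ h|_{\mathcal{X}_B}\in\mathcal{H}_B\},\qquad \mathcal{P}=\{\tfrac12P_A+\tfrac12P_B:\ P_A\in\mathcal{P}_A,\ P_B\in\mathcal{P}_B\}.$$ **Theorem.** There exist a domain $\mathcal{X}_B$ and a hypothesis class $\mathcal{H}_B$ of finite VC dimension on it such that the mixture problem $(\mathcal{H},\mathcal{P})$ has the following properties. 1. $\mathcal{H}$ has finite VC dimension. 2. The supervised rate is $1/\sqrt{\ell}$: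 $L(\ell,0,\mathcal{H},\mathcal{P})\asymp 1/\sqrt{\ell}$. 3. For every $u:\mathbb{N}\to\mathbb{N}$ with $u(\ell)\ge\ell^2$ for all $\ell$, the semi-supervised rate is $1/\ell$: $L(\ell,u(\ell),\mathcal{H},\mathcal{P})\asymp 1/\ell$. 4. The rate cannot be improved beyond $1/\ell$ by more unlabeled data: there is a constant $c>0$ such that $L(\ell,u(\ell),\mathcal{H},\mathcal{P})\ge c/\ell$ for every function $u:\mathbb{N}\to\mathbb{N}$ and every $\ell\ge1$. -/

import Mathlib

open MeasureTheory ProbabilityTheory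
open scoped ENNReal

namespace SSL

noncomputable section

/-- A learning problem on the feature space `X` with labels `{0, 1}` (`false` is `0`, `true` is
`1`): a hypothesis class and a set of admissible distributions on `X × {0, 1}`. -/
structure LearningProblem (X : Type) [MeasurableSpace X] where
  hyp : Set (X → Bool)
  measurable_hyp : ∀ h ∈ hyp, Measurable h
  dist : Set (ProbabilityMeasure (X × Bool))

/-- The class `H` shatters the finite set `s`: each labelling of `s` is induced by some `h ∈ H`. -/
def Shatters {X : Type} (H : Set (X → Bool)) (s : Finset X) : Prop :=
  ∀ g : X → Bool, ∃ h ∈ H, ∀ x ∈ s, h x = g x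

/-- `H` has finite VC dimension: the sizes of the shattered finite sets are bounded. -/
def HasFiniteVCDim {X : Type} (H : Set (X → Bool)) : Prop :=
  ∃ d : ℕ, ∀ s : Finset X, Shatters H s → s.card ≤ d

variable {X : Type} [MeasurableSpace X]

/-- The misclassification probability `R_P(f) = P(f(X) ≠ Y)`. -/
def risk (P : ProbabilityMeasure (X × Bool)) (f : X → Bool) : ℝ≥0∞ :=
  (P : Measure (X × Bool)) {z | f z.1 ≠ z.2}

/-- The minimal risk `R_{P,H}` over the hypotheses in `H`. -/
def bestRisk (P : ProbabilityMeasure (X × Bool)) (H : Set (X → Bool)) : ℝ≥0∞ :=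
  ⨅ h ∈ H, risk P h

/-- Samples made of `l` labeled and `u` unlabeled points. -/
abbrev Sample (X : Type) (l u : ℕ) : Type := (Fin l → X × Bool) × (Fin u → X)

/-- The distribution `P^l × P_X^u` of the sample. -/
def sampleMeasure (P : ProbabilityMeasure (X × Bool)) (l u : ℕ) : Measure (Sample X l u) :=
  (Measure.pi fun _ : Fin l => (P : Measure (X × Bool))).prod
    (Measure.pi fun _ : Fin u => (P : Measure (X × Bool)).map Prod.fst)

/-- A (semi-supervised) learning algorithm on samples of size `(l, u)`: it maps a sample to a
classifier, not necessarily in the hypothesis class. The predicted label depends measurably on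
the sample and the point, so that the risk of the output has an expectation. -/
structure Learner (X : Type) [MeasurableSpace X] (l u : ℕ) where
  toFun : Sample X l u → X → Bool
  measurable_toFun : Measurable fun p : Sample X l u × X => toFun p.1 p.2

/-- The expected excess risk `E_{S ∼ P^l × P_X^u} (R_P(A(S)) - R_{P,H})_+`. Subtraction in `ℝ≥0∞`
is truncated at `0`, which is the positive part. -/
def expectedExcessRisk {l u : ℕ} (A : Learner X l u) (H : Set (X → Bool))
    (P : ProbabilityMeasure (X × Bool)) : ℝ≥0∞ :=
  ∫⁻ S, (risk P (A.toFun S) - bestRisk P H) ∂(sampleMeasure P l u)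

/-- The minimax expected excess risk `L(l, u, H, 𝒫)`. -/
def LearningProblem.minimaxRisk (Q : LearningProblem X) (l u : ℕ) : ℝ≥0∞ :=
  ⨅ A : Learner X l u, ⨆ P ∈ Q.dist, expectedExcessRisk A Q.hyp P

/-- `f` has rate `g`: `c₁ g(l) ≤ f(l) ≤ c₂ g(l)` for all sample sizes `l ≥ 1`, with constants
`c₁, c₂ > 0`. -/
def HasRate (f : ℕ → ℝ≥0∞) (g : ℕ → ℝ) : Prop :=
  ∃ c₁ c₂ : ℝ, 0 < c₁ ∧ 0 < c₂ ∧ ∀ l : ℕ, 1 ≤ l →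
    ENNReal.ofReal (c₁ * g l) ≤ f l ∧ f l ≤ ENNReal.ofReal (c₂ * g l)

/-- The two-point problem: the domain is `{x₁, x₂}`, all classifiers are hypotheses, and the
admissible distributions give positive mass to both points and satisfy
`P(Y = 1 | x) = P_X(x)` at each of them. -/
def twoPointProblem : LearningProblem (Fin 2) where
  hyp := Set.univ
  measurable_hyp := fun _ _ => measurable_of_finite _
  dist := {P | ∀ x : Fin 2, (P : Measure (Fin 2 × Bool)) {z | z.1 = x} ≠ 0 ∧
    (P : Measure (Fin 2 × Bool))[{z | z.2 = true} | {z | z.1 = x}] =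
      (P : Measure (Fin 2 × Bool)) {z | z.1 = x}}

/-- The problem of learning `H` under the realizability assumption: all distributions for which
some hypothesis in `H` has risk zero are admissible. -/
def realizableProblem (H : Set (X → Bool)) (hH : ∀ h ∈ H, Measurable h) : LearningProblem X where
  hyp := H
  measurable_hyp := hH
  dist := {P | ∃ h ∈ H, risk P h = 0}

/-- The mixture of two problems, on the disjoint union of their domains: the hypotheses restrict
to hypotheses of the components, and the distributions are `½ P_A + ½ P_B`. -/
def mixtureProblem {XA XB : Type} [MeasurableSpace XA] [MeasurableSpace XB]
    (A : LearningProblem XA) (B : LearningProblem XB) : LearningProblem (XA ⊕ XB) where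
  hyp := {h | h ∘ Sum.inl ∈ A.hyp ∧ h ∘ Sum.inr ∈ B.hyp}
  measurable_hyp := fun _ hh =>
    measurable_fun_sum (A.measurable_hyp _ hh.1) (B.measurable_hyp _ hh.2)
  dist := {P | ∃ PA ∈ A.dist, ∃ PB ∈ B.dist, (P : Measure ((XA ⊕ XB) × Bool)) =
    (2⁻¹ : ℝ≥0∞) • (PA : Measure (XA × Bool)).map (Prod.map Sum.inl id) +
    (2⁻¹ : ℝ≥0∞) • (PB : Measure (XB × Bool)).map (Prod.map Sum.inr id)}

end

end SSL

/-!
In the two-point problem `P(x₁) = p` and `P(x₂) = 1 - p`, so one point has label probability at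
least `1/2` and the other at most `1/2`, and the Bayes classifier is determined by the sign of
`P(x₁) - P(x₂)`. This is a functional of the marginal, so labeled and unlabeled points are equally
useful for it: an empirical mean over `n` points estimates it with error `1/√n`, and choosing the
wrong sign costs only as much as the size of the difference. With `u ≥ l²` unlabeled points that
cost is at most `1/l`, while with `l` labeled points alone it is `1/√l`. On a finite `X_B`,
memorizing the labels costs at most `|X_B|/l`, since a point of mass `t` is missed with
probability at most `(1 - t)^l ≤ 1/(l t)`.

Both lower bounds are Le Cam's two-point method, with the overlap of the two sample distributions
measured by the Hellinger affinity. Shifting `p` from `1/2` by `±1/(4√l)` gives `1/√l`. For `1/l`,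
two hypotheses of `H_B` that agree at one point and differ at another are compared under a marginal
that gives mass `1/l` to the points where they differ: the two distributions have the same marginal,
so unlabeled points do not help.
-/

namespace SSL

noncomputable section

instance measurableSingletonClass_sum {α β : Type*} [MeasurableSpace α] [MeasurableSpace β]
    [MeasurableSingletonClass α] [MeasurableSingletonClass β] :
    MeasurableSingletonClass (α ⊕ β) where
  measurableSet_singleton
    | .inl a => by simpa using (measurableSet_singleton a).inl_image (β := β)
    | .inr b => by simpa using (measurableSet_singleton b).inr_image (α := α)

/-! ### Product distributions -/

section ProductMeasure

variable {Z ι : Type*} [MeasurableSpace Z] [Fintype ι] {μ : Measure Z} [IsProbabilityMeasure μ]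

theorem sq_integral_abs_sub_integral_le_variance {Y : Z → ℝ} (hY : MemLp Y 2 μ) :
    (∫ z, |Y z - ∫ z', Y z' ∂μ| ∂μ) ^ 2 ≤ Var[Y; μ] := by
  have hdev : MemLp (fun z => |Y z - ∫ z', Y z' ∂μ|) 2 μ := (hY.sub (memLp_const _)).abs
  have hnonneg := variance_nonneg (fun z => |Y z - ∫ z', Y z' ∂μ|) μ
  rw [variance_eq_sub hdev] at hnonneg
  simp only [Pi.pow_apply, sq_abs] at hnonneg
  rw [variance_eq_integral hY.aestronglyMeasurable.aemeasurable]
  linarith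

theorem integral_abs_empiricalMean_sub_le [Nonempty ι] {g : Z → ℝ} (hg : MemLp g 2 μ) :
    ∫ S : ι → Z, |(∑ i, g (S i)) / Fintype.card ι - ∫ z, g z ∂μ| ∂(Measure.pi fun _ => μ) ≤
      √(Var[g; μ] / Fintype.card ι) := by
  have hcard : (Fintype.card ι : ℝ) ≠ 0 := by simp
  have heval (i : ι) : MemLp (fun S : ι → Z => g (S i)) 2 (Measure.pi fun _ => μ) :=
    hg.comp_measurePreserving (measurePreserving_eval _ i)
  have hmeanLp : MemLp (fun S : ι → Z => (∑ i, g (S i)) / Fintype.card ι) 2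
      (Measure.pi fun _ => μ) := by
    simpa only [div_eq_inv_mul] using (memLp_finsetSum _ fun i _ => heval i).const_mul _
  have hmean : ∫ S : ι → Z, (∑ i, g (S i)) / Fintype.card ι ∂(Measure.pi fun _ => μ) =
      ∫ z, g z ∂μ := by
    rw [integral_div, integral_finsetSum _ fun i _ => (heval i).integrable one_le_two]
    have hcoord (i : ι) : ∫ S : ι → Z, g (S i) ∂(Measure.pi fun _ => μ) = ∫ z, g z ∂μ :=
      integral_comp_eval (μ := fun _ : ι => μ) hg.aestronglyMeasurable
    simp only [hcoord, Finset.sum_const, Finset.card_univ, nsmul_eq_mul]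
    field_simp
  have hvar : Var[fun S : ι → Z => (∑ i, g (S i)) / Fintype.card ι; Measure.pi fun _ => μ] =
      Var[g; μ] / Fintype.card ι := by
    have hsum := variance_sum_pi (μ := fun _ : ι => μ) fun _ => hg
    simp only [Finset.sum_fn, Finset.sum_const, Finset.card_univ, nsmul_eq_mul] at hsum
    simp only [div_eq_inv_mul, variance_const_mul, hsum]
    field_simp
  refine Real.le_sqrt_of_sq_le ?_
  rw [← hmean, ← hvar]
  exact sq_integral_abs_sub_integral_le_variance hmeanLp

theorem lintegral_abs_empiricalMean_sub_le [Nonempty ι] {g : Z → ℝ} (hg : Measurable g)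
    (hbound : ∀ z, |g z| ≤ 1) :
    ∫⁻ S : ι → Z, ENNReal.ofReal |(∑ i, g (S i)) / Fintype.card ι - ∫ z, g z ∂μ|
      ∂(Measure.pi fun _ => μ) ≤ ENNReal.ofReal (1 / √(Fintype.card ι)) := by
  have hLp : MemLp g 2 μ := .of_bound hg.aestronglyMeasurable 1 (.of_forall hbound)
  have hvar : Var[g; μ] ≤ 1 := by
    simpa using variance_le_sq_of_bounded (μ := μ) (.of_forall fun z => abs_le.1 (hbound z))
      hg.aemeasurable
  have heval (i : ι) : Integrable (fun S : ι → Z => g (S i)) (Measure.pi fun _ => μ) :=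
    (hLp.comp_measurePreserving (measurePreserving_eval _ i)).integrable one_le_two
  have hint : Integrable (fun S : ι → Z => |(∑ i, g (S i)) / Fintype.card ι - ∫ z, g z ∂μ|)
      (Measure.pi fun _ => μ) :=
    (((integrable_finsetSum _ fun i _ => heval i).div_const _).sub (integrable_const _)).abs
  rw [← ofReal_integral_eq_lintegral_ofReal hint (.of_forall fun _ => abs_nonneg _)]
  refine ENNReal.ofReal_le_ofReal ((integral_abs_empiricalMean_sub_le hLp).trans ?_)
  calc √(Var[g; μ] / Fintype.card ι)
    _ ≤ √(1 / Fintype.card ι) := by gcongr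
    _ = 1 / √(Fintype.card ι) := by rw [Real.sqrt_div zero_le_one, Real.sqrt_one]

theorem pi_forall_ne_singleton [MeasurableSingletonClass Z] (z : Z) :
    (Measure.pi fun _ : ι => μ) {S | ∀ i, S i ≠ z} = (1 - μ {z}) ^ Fintype.card ι := by
  have hset : {S : ι → Z | ∀ i, S i ≠ z} = Set.univ.pi fun _ => {z}ᶜ := by
    ext S
    simp
  rw [hset, Measure.pi_pi, prob_compl_eq_one_sub (measurableSet_singleton z), Finset.prod_const,
    Finset.card_univ]

theorem mul_one_sub_pow_le_one_div {t : ℝ} (h0 : 0 ≤ t) (h1 : t ≤ 1) {n : ℕ} (hn : n ≠ 0) :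
    t * (1 - t) ^ n ≤ 1 / n := by
  have hbernoulli : 1 + n * t ≤ (1 + t) ^ n := one_add_mul_le_pow (by linarith) n
  have hprod : (1 + t) ^ n * (1 - t) ^ n ≤ 1 := by
    rw [← mul_pow]
    exact pow_le_one₀ (by nlinarith) (by nlinarith)
  have hpow : 0 ≤ (1 - t) ^ n := pow_nonneg (by linarith) n
  rw [le_div_iff₀ (by positivity)]
  nlinarith [mul_le_mul_of_nonneg_right hbernoulli hpow]

theorem measure_singleton_mul_pi_forall_ne_le [MeasurableSingletonClass Z] [Nonempty ι] (z : Z) :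
    μ {z} * (Measure.pi fun _ : ι => μ) {S | ∀ i, S i ≠ z} ≤
      ENNReal.ofReal (1 / Fintype.card ι) := by
  rw [pi_forall_ne_singleton, ← ofReal_measureReal, ← ENNReal.ofReal_one,
    ← ENNReal.ofReal_sub _ measureReal_nonneg,
    ← ENNReal.ofReal_pow (sub_nonneg.2 measureReal_le_one), ← ENNReal.ofReal_mul measureReal_nonneg]
  exact ENNReal.ofReal_le_ofReal
    (mul_one_sub_pow_le_one_div measureReal_nonneg measureReal_le_one Fintype.card_ne_zero)

theorem lintegral_measure_not_seen_le {X : Type*} [MeasurableSpace X] [MeasurableSingletonClass X]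
    [Nonempty ι] {P : Measure (X × Bool)} [IsProbabilityMeasure P] {x : X}
    [∀ S : ι → X × Bool, Decidable (∃ i, S i = (x, true))]
    (hx : P {(x, true)} = 0 ∨ P {(x, false)} = 0) :
    ∫⁻ S : ι → X × Bool, P {(x, !decide (∃ i, S i = (x, true)))} ∂(Measure.pi fun _ => P) ≤
      ENNReal.ofReal (1 / Fintype.card ι) := by
  set unseen : Set (ι → X × Bool) := {S | ∀ i, S i ≠ (x, true)}
  have hmeas : MeasurableSet unseen := by
    simp only [unseen, Set.ofPred_forall]
    exact .iInter fun i => measurable_pi_apply i (measurableSet_singleton _).compl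
  have hunseen : ∫⁻ S in unseen, P {(x, !decide (∃ i, S i = (x, true)))} ∂(Measure.pi fun _ => P) =
      P {(x, true)} * Measure.pi (fun _ => P) unseen := by
    rw [← setLIntegral_const]
    refine setLIntegral_congr_fun hmeas fun S hS => ?_
    simp only [decide_eq_false (not_exists.2 hS), Bool.not_false]
  have hseen : ∫⁻ S in unseenᶜ, P {(x, !decide (∃ i, S i = (x, true)))} ∂(Measure.pi fun _ => P) =
      P {(x, false)} * Measure.pi (fun _ => P) unseenᶜ := by
    rw [← setLIntegral_const]
    refine setLIntegral_congr_fun hmeas.compl fun S hS => ?_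
    simp only [unseen, Set.mem_compl_iff, Set.mem_ofPred_eq, not_forall, not_not] at hS
    simp only [decide_eq_true hS, Bool.not_true]
  have hzero : P {(x, false)} * Measure.pi (fun _ : ι => P) unseenᶜ = 0 := by
    rcases hx with htrue | hfalse
    · rw [prob_compl_eq_one_sub hmeas, pi_forall_ne_singleton, htrue]
      simp
    · rw [hfalse, zero_mul]
  rw [← lintegral_add_compl _ hmeas, hunseen, hseen, hzero, add_zero]
  exact measure_singleton_mul_pi_forall_ne_le _

end ProductMeasure

/-! ### Hellinger affinity and Le Cam's two-point method -/

section Affinity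

variable {Z W : Type*} [Fintype Z] [Fintype W] [MeasurableSpace Z] [MeasurableSpace W]

/-- The Hellinger affinity `∑ √(μ {z} ν {z})` of two measures on a finite space. It multiplies over
products, which makes it convenient for bounding the overlap of two sample distributions. -/
def affinity (μ ν : Measure Z) : ℝ := ∑ z, √(μ.real {z} * ν.real {z})

theorem affinity_nonneg (μ ν : Measure Z) : 0 ≤ affinity μ ν :=
  Finset.sum_nonneg fun _ _ => Real.sqrt_nonneg _

theorem affinity_prod (μ μ' : Measure Z) (ν ν' : Measure W) [SFinite ν] [SFinite ν'] :
    affinity (μ.prod ν) (μ'.prod ν') = affinity μ μ' * affinity ν ν' := by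
  simp only [affinity, Finset.sum_mul_sum, Fintype.sum_prod_type,
    ← Set.singleton_prod_singleton, measureReal_prod_prod]
  refine Finset.sum_congr rfl fun z _ => Finset.sum_congr rfl fun w _ => ?_
  rw [← Real.sqrt_mul (by positivity), mul_mul_mul_comm]

theorem affinity_pi {ι : Type*} [Fintype ι] [DecidableEq ι] (μ ν : Measure Z) [SigmaFinite μ]
    [SigmaFinite ν] :
    affinity (Measure.pi fun _ : ι => μ) (Measure.pi fun _ : ι => ν) =
      affinity μ ν ^ Fintype.card ι := by
  simp only [affinity, Measure.real, Measure.pi_singleton, ENNReal.toReal_prod,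
    ← Finset.prod_mul_distrib]
  rw [← Finset.card_univ, ← Finset.prod_const, Finset.prod_univ_sum, Fintype.piFinset_univ]
  exact Finset.sum_congr rfl fun S _ => Real.sqrt_prod _ fun i _ => by positivity

variable [MeasurableSingletonClass Z] (μ ν : Measure Z) [IsProbabilityMeasure μ]

theorem affinity_self : affinity μ μ = 1 := by
  simp [affinity, Real.sqrt_mul_self, sum_measureReal_singleton]

variable [IsProbabilityMeasure ν]

theorem affinity_sq_le_two_mul_sum_min :
    affinity μ ν ^ 2 ≤ 2 * ∑ z, min (μ.real {z}) (ν.real {z}) := by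
  have hmax : ∑ z, max (μ.real {z}) (ν.real {z}) ≤ 2 := by
    calc ∑ z, max (μ.real {z}) (ν.real {z})
      _ ≤ ∑ z, (μ.real {z} + ν.real {z}) :=
        Finset.sum_le_sum fun z _ => max_le_add_of_nonneg measureReal_nonneg measureReal_nonneg
      _ = 2 := by
        rw [Finset.sum_add_distrib, sum_measureReal_singleton, sum_measureReal_singleton]
        simp [one_add_one_eq_two]
  calc affinity μ ν ^ 2
    _ ≤ (∑ z, min (μ.real {z}) (ν.real {z})) * ∑ z, max (μ.real {z}) (ν.real {z}) := by
      refine Finset.sum_sq_le_sum_mul_sum_of_sq_le_mul _ (fun z _ => by positivity)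
        (fun z _ => by positivity) fun z _ => ?_
      exact (Real.sq_sqrt (by positivity)).trans_le (min_mul_max _ _).ge
    _ ≤ (∑ z, min (μ.real {z}) (ν.real {z})) * 2 := by gcongr
    _ = _ := mul_comm _ _

theorem mul_affinity_sq_le_lintegral_add_lintegral {F G : Z → ℝ≥0∞} {c : ℝ≥0∞}
    (hFG : ∀ z, c ≤ F z + G z) :
    c * ENNReal.ofReal (affinity μ ν ^ 2) ≤ 2 * (∫⁻ z, F z ∂μ + ∫⁻ z, G z ∂ν) := by
  have hoverlap : ENNReal.ofReal (∑ z, min (μ.real {z}) (ν.real {z})) =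
      ∑ z, min (μ {z}) (ν {z}) := by
    simp [ENNReal.ofReal_sum_of_nonneg, ENNReal.ofReal_min]
  calc c * ENNReal.ofReal (affinity μ ν ^ 2)
    _ ≤ c * (2 * ∑ z, min (μ {z}) (ν {z})) := by
      rw [← hoverlap, ← ENNReal.ofReal_ofNat 2, ← ENNReal.ofReal_mul zero_le_two]
      gcongr
      exact affinity_sq_le_two_mul_sum_min μ ν
    _ = 2 * ∑ z, c * min (μ {z}) (ν {z}) := by rw [← Finset.mul_sum, mul_left_comm]
    _ ≤ 2 * ∑ z, (F z * μ {z} + G z * ν {z}) := by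
      gcongr with z
      calc c * min (μ {z}) (ν {z})
        _ ≤ F z * min (μ {z}) (ν {z}) + G z * min (μ {z}) (ν {z}) := by
          rw [← add_mul]
          gcongr
          exact hFG z
        _ ≤ F z * μ {z} + G z * ν {z} := by
          gcongr
          exacts [min_le_left _ _, min_le_right _ _]
    _ = _ := by rw [Finset.sum_add_distrib, lintegral_fintype, lintegral_fintype]

end Affinity

/-! ### Learning problems -/

section Learning

theorem hasFiniteVCDim_of_finite {X : Type} [Finite X] (H : Set (X → Bool)) : HasFiniteVCDim H :=
  ⟨Nat.card X, fun s _ => by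
    have := Fintype.ofFinite X
    rw [Nat.card_eq_fintype_card]
    exact s.card_le_univ⟩

variable {X : Type} [MeasurableSpace X] {H : Set (X → Bool)} {P : ProbabilityMeasure (X × Bool)}

instance : IsProbabilityMeasure ((P : Measure (X × Bool)).map Prod.fst) :=
  Measure.isProbabilityMeasure_map measurable_fst.aemeasurable

instance (l u : ℕ) : IsProbabilityMeasure (sampleMeasure P l u) := by
  unfold sampleMeasure
  infer_instance

theorem lintegral_sampleMeasure_fst (P : ProbabilityMeasure (X × Bool)) {l : ℕ} (u : ℕ)
    {g : (Fin l → X × Bool) → ℝ≥0∞} (hg : Measurable g) :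
    ∫⁻ S, g S.1 ∂(sampleMeasure P l u) =
      ∫⁻ S, g S ∂(Measure.pi fun _ => (P : Measure (X × Bool))) :=
  measurePreserving_fst.lintegral_comp hg

theorem lintegral_sampleMeasure_snd (P : ProbabilityMeasure (X × Bool)) (l : ℕ) {u : ℕ}
    {g : (Fin u → X) → ℝ≥0∞} (hg : Measurable g) :
    ∫⁻ S, g S.2 ∂(sampleMeasure P l u) =
      ∫⁻ S, g S ∂(Measure.pi fun _ => (P : Measure (X × Bool)).map Prod.fst) :=
  measurePreserving_snd.lintegral_comp hg

theorem real_fst_eq_add [MeasurableSingletonClass X] (P : ProbabilityMeasure (X × Bool)) (x : X) :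
    (P : Measure (X × Bool)).real {z | z.1 = x} =
      (P : Measure (X × Bool)).real {(x, true)} + (P : Measure (X × Bool)).real {(x, false)} := by
  rw [← measureReal_union (by simp) (measurableSet_singleton _)]
  congr 1
  ext ⟨x', y⟩
  cases y <;> simp

/-- The excess risk `(R_P(f) - R_{P,H})_+` of a classifier `f`, relative to the class `H`. -/
def excessRisk (P : ProbabilityMeasure (X × Bool)) (H : Set (X → Bool)) (f : X → Bool) : ℝ≥0∞ :=
  risk P f - bestRisk P H

theorem bestRisk_eq_zero {h : X → Bool} (hh : h ∈ H) (hP : risk P h = 0) : bestRisk P H = 0 :=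
  le_antisymm (hP ▸ iInf₂_le h hh) zero_le

theorem risk_eq_sum [Fintype X] [MeasurableSingletonClass X] (P : ProbabilityMeasure (X × Bool))
    (f : X → Bool) : risk P f = ∑ x, (P : Measure (X × Bool)) {(x, !f x)} := by
  classical
  have hset : {z : X × Bool | f z.1 ≠ z.2} = (Finset.univ.image fun x => (x, !f x) : Finset _) := by
    ext ⟨x, y⟩
    cases y <;> simp
  rw [risk, hset, ← sum_measure_singleton,
    Finset.sum_image fun x _ x' _ h => congrArg Prod.fst h]

theorem bestRisk_univ [Fintype X] [MeasurableSingletonClass X]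
    (P : ProbabilityMeasure (X × Bool)) :
    bestRisk P Set.univ = ∑ x, min ((P : Measure (X × Bool)) {(x, true)})
      ((P : Measure (X × Bool)) {(x, false)}) := by
  refine le_antisymm ?_ (le_iInf₂ fun f _ => ?_)
  · refine (iInf₂_le (fun x => decide ((P : Measure (X × Bool)) {(x, false)} ≤
      (P : Measure (X × Bool)) {(x, true)})) (Set.mem_univ _)).trans_eq ?_
    rw [risk_eq_sum]
    refine Finset.sum_congr rfl fun x _ => ?_
    by_cases hx : (P : Measure (X × Bool)) {(x, false)} ≤ (P : Measure (X × Bool)) {(x, true)}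
    · simp [hx]
    · simp [hx, (not_le.1 hx).le]
  · rw [risk_eq_sum]
    gcongr with x
    cases f x <;> simp

theorem excessRisk_univ [Fintype X] [MeasurableSingletonClass X]
    (P : ProbabilityMeasure (X × Bool)) (f : X → Bool) :
    excessRisk P Set.univ f = ∑ x, ENNReal.ofReal
      ((P : Measure (X × Bool)).real {(x, !f x)} - (P : Measure (X × Bool)).real {(x, f x)}) := by
  have hbest : bestRisk P Set.univ ≠ ∞ := by
    rw [bestRisk_univ]
    exact ENNReal.sum_ne_top.2 fun x _ => ne_top_of_le_ne_top (measure_ne_top _ _) (min_le_left _ _)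
  refine (ENNReal.eq_sub_of_add_eq hbest ?_).symm
  rw [bestRisk_univ, risk_eq_sum, ← Finset.sum_add_distrib]
  refine Finset.sum_congr rfl fun x _ => ?_
  rw [ENNReal.ofReal_sub _ measureReal_nonneg, ofReal_measureReal, ofReal_measureReal]
  cases f x
  · simp [tsub_add_min]
  · simp [min_comm, tsub_add_min]

variable [Fintype X]

theorem affinity_sampleMeasure (P Q : ProbabilityMeasure (X × Bool)) (l u : ℕ) :
    affinity (sampleMeasure P l u) (sampleMeasure Q l u) =
      affinity (P : Measure (X × Bool)) Q ^ l *
        affinity ((P : Measure (X × Bool)).map Prod.fst) ((Q : Measure (X × Bool)).map Prod.fst) ^ u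
    := by
  simp [sampleMeasure, affinity_prod, affinity_pi]

variable [MeasurableSingletonClass X] (Q : LearningProblem X)
  {P₀ P₁ : ProbabilityMeasure (X × Bool)}

theorem mul_affinity_sq_le_minimaxRisk (hP₀ : P₀ ∈ Q.dist) (hP₁ : P₁ ∈ Q.dist) {c : ℝ≥0∞}
    (hc : ∀ f, c ≤ excessRisk P₀ Q.hyp f + excessRisk P₁ Q.hyp f) (l u : ℕ) :
    c * ENNReal.ofReal (affinity (sampleMeasure P₀ l u) (sampleMeasure P₁ l u) ^ 2) ≤
      4 * Q.minimaxRisk l u := by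
  rw [LearningProblem.minimaxRisk, ENNReal.mul_iInf_of_ne four_ne_zero ENNReal.ofNat_ne_top]
  refine le_iInf fun A => ?_
  have hsup {P : ProbabilityMeasure (X × Bool)} (hP : P ∈ Q.dist) :
      expectedExcessRisk A Q.hyp P ≤ ⨆ P ∈ Q.dist, expectedExcessRisk A Q.hyp P :=
    le_iSup₂_of_le P hP le_rfl
  calc c * ENNReal.ofReal (affinity (sampleMeasure P₀ l u) (sampleMeasure P₁ l u) ^ 2)
    _ ≤ 2 * (expectedExcessRisk A Q.hyp P₀ + expectedExcessRisk A Q.hyp P₁) :=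
      mul_affinity_sq_le_lintegral_add_lintegral _ _ fun S => hc (A.toFun S)
    _ ≤ 2 * ((⨆ P ∈ Q.dist, expectedExcessRisk A Q.hyp P) +
          ⨆ P ∈ Q.dist, expectedExcessRisk A Q.hyp P) := by
      gcongr <;> exact hsup ‹_›
    _ = _ := by rw [← two_mul, ← mul_assoc]; norm_num

theorem ofReal_le_minimaxRisk (hP₀ : P₀ ∈ Q.dist) (hP₁ : P₁ ∈ Q.dist) {l u : ℕ}
    (hl : l * (1 - affinity (P₀ : Measure (X × Bool)) P₁) ≤ 1 / 2)
    (hu : affinity ((P₀ : Measure (X × Bool)).map Prod.fst)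
      ((P₁ : Measure (X × Bool)).map Prod.fst) ^ u = 1) {r : ℝ}
    (hr : ∀ f, ENNReal.ofReal (16 * r) ≤ excessRisk P₀ Q.hyp f + excessRisk P₁ Q.hyp f) :
    ENNReal.ofReal r ≤ Q.minimaxRisk l u := by
  have haff : 1 / 2 ≤ affinity (sampleMeasure P₀ l u) (sampleMeasure P₁ l u) := by
    rw [affinity_sampleMeasure, hu, mul_one]
    have hnonneg := affinity_nonneg (P₀ : Measure (X × Bool)) P₁
    linarith [one_add_mul_sub_le_pow (a := affinity (P₀ : Measure (X × Bool)) P₁)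
      (by linarith) l]
  have hsq : (4 : ℝ)⁻¹ ≤ affinity (sampleMeasure P₀ l u) (sampleMeasure P₁ l u) ^ 2 := by nlinarith
  have hlecam := mul_affinity_sq_le_minimaxRisk Q hP₀ hP₁ hr l u
  have hscale : 4 * ENNReal.ofReal r ≤ 4 * Q.minimaxRisk l u := by
    refine le_trans ?_ hlecam
    calc 4 * ENNReal.ofReal r
      _ = ENNReal.ofReal (16 * r) * ENNReal.ofReal 4⁻¹ := by
        rw [← ENNReal.ofReal_ofNat 4, ← ENNReal.ofReal_mul (by norm_num),
          ← ENNReal.ofReal_mul' (by norm_num)]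
        ring_nf
      _ ≤ _ := by gcongr
  rwa [ENNReal.mul_le_mul_iff_right four_ne_zero ENNReal.ofNat_ne_top] at hscale

end Learning

/-! ### Mixtures -/

section Mixture

variable {XA XB : Type} [MeasurableSpace XA] [MeasurableSpace XB]
  (PA : ProbabilityMeasure (XA × Bool)) (PB : ProbabilityMeasure (XB × Bool))

/-- The distribution `½ P_A + ½ P_B` on the disjoint union of the domains. -/
def mixture : ProbabilityMeasure ((XA ⊕ XB) × Bool) :=
  ⟨(2⁻¹ : ℝ≥0∞) • (PA : Measure (XA × Bool)).map (Prod.map Sum.inl id) +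
    (2⁻¹ : ℝ≥0∞) • (PB : Measure (XB × Bool)).map (Prod.map Sum.inr id), ⟨by
    simp [Measure.map_apply (measurable_inl.prodMap measurable_id),
      Measure.map_apply (measurable_inr.prodMap measurable_id), ENNReal.inv_two_add_inv_two]⟩⟩

theorem mem_mixtureProblem_dist {A : LearningProblem XA} {B : LearningProblem XB}
    {P : ProbabilityMeasure ((XA ⊕ XB) × Bool)} :
    P ∈ (mixtureProblem A B).dist ↔ ∃ PA ∈ A.dist, ∃ PB ∈ B.dist, P = mixture PA PB :=
  exists_congr fun PA => and_congr_right fun _ => exists_congr fun PB => and_congr_right fun _ =>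
    (Subtype.ext_iff (a1 := P) (a2 := mixture PA PB)).symm

theorem mixture_apply {s : Set ((XA ⊕ XB) × Bool)} (hs : MeasurableSet s) :
    (mixture PA PB : Measure ((XA ⊕ XB) × Bool)) s =
      2⁻¹ * (PA : Measure (XA × Bool)) (Prod.map Sum.inl id ⁻¹' s) +
        2⁻¹ * (PB : Measure (XB × Bool)) (Prod.map Sum.inr id ⁻¹' s) := by
  simp [mixture, Measure.map_apply (measurable_inl.prodMap measurable_id) hs,
    Measure.map_apply (measurable_inr.prodMap measurable_id) hs]

theorem map_fst_mixture :
    (mixture PA PB : Measure ((XA ⊕ XB) × Bool)).map Prod.fst =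
      (2⁻¹ : ℝ≥0∞) • ((PA : Measure (XA × Bool)).map Prod.fst).map Sum.inl +
        (2⁻¹ : ℝ≥0∞) • ((PB : Measure (XB × Bool)).map Prod.fst).map Sum.inr := by
  ext s hs
  rw [Measure.map_apply measurable_fst hs, mixture_apply PA PB (measurable_fst hs)]
  simp [Measure.map_apply, measurable_inl, measurable_inr, measurable_fst, hs, measurable_inl hs,
    measurable_inr hs, Set.preimage_preimage]

theorem risk_mixture {f : XA ⊕ XB → Bool} (hf : Measurable f) :
    risk (mixture PA PB) f = 2⁻¹ * risk PA (f ∘ Sum.inl) + 2⁻¹ * risk PB (f ∘ Sum.inr) :=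
  mixture_apply PA PB (measurableSet_eq_fun (hf.comp measurable_fst) measurable_snd).compl

theorem bestRisk_mixture (A : LearningProblem XA) (B : LearningProblem XB) :
    bestRisk (mixture PA PB) (mixtureProblem A B).hyp =
      2⁻¹ * bestRisk PA A.hyp + 2⁻¹ * bestRisk PB B.hyp := by
  refine le_antisymm ?_ (le_iInf₂ fun h hh => ?_)
  · have htwo : (2⁻¹ : ℝ≥0∞) ≠ 0 := ENNReal.inv_ne_zero.2 ENNReal.ofNat_ne_top
    have htop : (2⁻¹ : ℝ≥0∞) ≠ ∞ := ENNReal.inv_ne_top.2 two_ne_zero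
    simp only [bestRisk, ENNReal.mul_iInf_of_ne htwo htop, ENNReal.iInf_add, ENNReal.add_iInf]
    refine le_iInf₂ fun hB hhB => le_iInf₂ fun hA hhA => ?_
    have hmem : Sum.elim hA hB ∈ (mixtureProblem A B).hyp := ⟨hhA, hhB⟩
    exact (iInf₂_le _ hmem).trans_eq
      (risk_mixture PA PB ((mixtureProblem A B).measurable_hyp _ hmem))
  · rw [risk_mixture PA PB ((mixtureProblem A B).measurable_hyp h hh)]
    gcongr
    exacts [iInf₂_le _ hh.1, iInf₂_le _ hh.2]

theorem excessRisk_mixture {A : LearningProblem XA} {B : LearningProblem XB}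
    (hPB : bestRisk PB B.hyp = 0) {f : XA ⊕ XB → Bool} (hfA : f ∘ Sum.inl ∈ A.hyp)
    (hfB : Measurable (f ∘ Sum.inr)) :
    excessRisk (mixture PA PB) (mixtureProblem A B).hyp f =
      2⁻¹ * excessRisk PA A.hyp (f ∘ Sum.inl) + 2⁻¹ * risk PB (f ∘ Sum.inr) := by
  have hbest : bestRisk PA A.hyp ≤ risk PA (f ∘ Sum.inl) := iInf₂_le _ hfA
  rw [excessRisk, bestRisk_mixture, hPB,
    risk_mixture PA PB (measurable_fun_sum (A.measurable_hyp _ hfA) hfB), mul_zero, add_zero,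
    excessRisk, ENNReal.mul_sub fun _ _ => ENNReal.inv_ne_top.2 two_ne_zero]
  have hfinite : 2⁻¹ * bestRisk PA A.hyp ≠ ∞ :=
    ENNReal.mul_ne_top (ENNReal.inv_ne_top.2 two_ne_zero)
      (ne_top_of_le_ne_top (measure_ne_top _ _) hbest)
  exact ((ENNReal.cancel_of_ne hfinite).tsub_add_eq_add_tsub (by gcongr)).symm

theorem mixture_singleton_inl [MeasurableSingletonClass XA] [MeasurableSingletonClass XB] (x : XA)
    (y : Bool) :
    (mixture PA PB : Measure ((XA ⊕ XB) × Bool)) {(.inl x, y)} =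
      2⁻¹ * (PA : Measure (XA × Bool)) {(x, y)} := by
  have hinl : (Prod.map Sum.inl id ⁻¹' {((.inl x : XA ⊕ XB), y)} : Set (XA × Bool)) = {(x, y)} := by
    ext
    simp [Prod.ext_iff]
  have hinr : (Prod.map Sum.inr id ⁻¹' {((.inl x : XA ⊕ XB), y)} : Set (XB × Bool)) = ∅ := by
    ext
    simp [Prod.ext_iff]
  simp [mixture_apply PA PB (measurableSet_singleton _), hinl, hinr]

theorem mixture_singleton_inr [MeasurableSingletonClass XA] [MeasurableSingletonClass XB] (x : XB)
    (y : Bool) :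
    (mixture PA PB : Measure ((XA ⊕ XB) × Bool)) {(.inr x, y)} =
      2⁻¹ * (PB : Measure (XB × Bool)) {(x, y)} := by
  have hinl : (Prod.map Sum.inl id ⁻¹' {((.inr x : XA ⊕ XB), y)} : Set (XA × Bool)) = ∅ := by
    ext
    simp [Prod.ext_iff]
  have hinr : (Prod.map Sum.inr id ⁻¹' {((.inr x : XA ⊕ XB), y)} : Set (XB × Bool)) = {(x, y)} := by
    ext
    simp [Prod.ext_iff]
  simp [mixture_apply PA PB (measurableSet_singleton _), hinl, hinr]

theorem affinity_mixture [Fintype XA] [Fintype XB] [MeasurableSingletonClass XA]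
    [MeasurableSingletonClass XB] (PA PA' : ProbabilityMeasure (XA × Bool))
    (PB PB' : ProbabilityMeasure (XB × Bool)) :
    affinity (mixture PA PB : Measure ((XA ⊕ XB) × Bool)) (mixture PA' PB') =
      (affinity (PA : Measure (XA × Bool)) PA' + affinity (PB : Measure (XB × Bool)) PB') / 2 := by
  have hsqrt (a b : ℝ) : √(2⁻¹ * a * (2⁻¹ * b)) = √(a * b) / 2 := by
    rw [show 2⁻¹ * a * (2⁻¹ * b) = 2⁻¹ ^ 2 * (a * b) by ring,
      Real.sqrt_mul (by positivity), Real.sqrt_sq (by positivity), div_eq_inv_mul]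
  simp only [affinity, Fintype.sum_prod_type, Fintype.sum_sum_type, Measure.real,
    mixture_singleton_inl, mixture_singleton_inr, ENNReal.toReal_mul, ENNReal.toReal_inv,
    ENNReal.toReal_ofNat, hsqrt, ← Finset.sum_div, add_div]

end Mixture

/-! ### Realizable distributions -/

theorem exists_real_singleton_eq {Z : Type*} [Fintype Z] [MeasurableSpace Z]
    [MeasurableSingletonClass Z] {w : Z → ℝ} (h0 : ∀ z, 0 ≤ w z) (h1 : ∑ z, w z = 1) :
    ∃ μ : ProbabilityMeasure Z, ∀ z, (μ : Measure Z).real {z} = w z := by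
  have hsum : ∑ z, ENNReal.ofReal (w z) = 1 := by
    rw [← ENNReal.ofReal_sum_of_nonneg fun z _ => h0 z, h1, ENNReal.ofReal_one]
  refine ⟨⟨(PMF.ofFintype (fun z => ENNReal.ofReal (w z)) hsum).toMeasure, inferInstance⟩,
    fun z => ?_⟩
  simp [Measure.real, PMF.toMeasure_apply_singleton _ _ (measurableSet_singleton z), h0]

section Realizable

variable {X : Type} [MeasurableSpace X]

/-- The distribution of `(x, h x)` for `x ∼ ν`. -/
def labeledBy (ν : ProbabilityMeasure X) {h : X → Bool} (hh : Measurable h) :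
    ProbabilityMeasure (X × Bool) :=
  ν.map (measurable_id.prodMk hh).aemeasurable

theorem map_fst_labeledBy (ν : ProbabilityMeasure X) {h : X → Bool} (hh : Measurable h) :
    (labeledBy ν hh : Measure (X × Bool)).map Prod.fst = ν := by
  simp only [labeledBy, ProbabilityMeasure.toMeasure_map]
  rw [Measure.map_map measurable_fst (measurable_id.prodMk hh)]
  exact Measure.map_id

theorem risk_labeledBy (ν : ProbabilityMeasure X) {h f : X → Bool} (hh : Measurable h)
    (hf : Measurable f) : risk (labeledBy ν hh) f = (ν : Measure X) {x | f x ≠ h x} :=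
  Measure.map_apply (measurable_id.prodMk hh)
    (measurableSet_eq_fun (hf.comp measurable_fst) measurable_snd).compl

theorem risk_labeledBy_self (ν : ProbabilityMeasure X) {h : X → Bool} (hh : Measurable h) :
    risk (labeledBy ν hh) h = 0 := by
  simp [risk_labeledBy ν hh hh]

theorem measure_ne_le_risk_add_risk (ν : ProbabilityMeasure X) {h₀ h₁ f : X → Bool}
    (hh₀ : Measurable h₀) (hh₁ : Measurable h₁) (hf : Measurable f) :
    (ν : Measure X) {x | h₀ x ≠ h₁ x} ≤ risk (labeledBy ν hh₀) f + risk (labeledBy ν hh₁) f := by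
  rw [risk_labeledBy ν hh₀ hf, risk_labeledBy ν hh₁ hf]
  refine (measure_mono fun x hx => ?_).trans (measure_union_le _ _)
  exact not_and_or.1 fun hf => hx (hf.1.symm.trans hf.2)

theorem affinity_labeledBy [Fintype X] [MeasurableSingletonClass X] (ν : ProbabilityMeasure X)
    {h₀ h₁ : X → Bool} (hh₀ : Measurable h₀) (hh₁ : Measurable h₁) :
    affinity (labeledBy ν hh₀ : Measure (X × Bool)) (labeledBy ν hh₁) =
      (ν : Measure X).real {x | h₀ x = h₁ x} := by
  have hsingleton {h : X → Bool} (hh : Measurable h) (x : X) (y : Bool) :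
      (labeledBy ν hh : Measure (X × Bool)).real {(x, y)} =
        if h x = y then (ν : Measure X).real {x} else 0 := by
    rw [labeledBy, ProbabilityMeasure.toMeasure_map, map_measureReal_apply
      (measurable_id.prodMk hh) (measurableSet_singleton _)]
    split_ifs with hx
    · congr 1
      ext x'
      simp only [Set.mem_preimage, Set.mem_singleton_iff, Prod.mk.injEq, id]
      grind
    · convert measureReal_empty
      ext x'
      simp only [Set.mem_preimage, Set.mem_singleton_iff, Prod.mk.injEq, id]
      grind
  have hset : {x | h₀ x = h₁ x} = (Finset.univ.filter fun x => h₀ x = h₁ x : Finset X) := by simp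
  rw [hset, ← sum_measureReal_singleton, Finset.sum_filter, affinity, Fintype.sum_prod_type]
  refine Finset.sum_congr rfl fun x _ => ?_
  simp only [hsingleton, Fintype.sum_bool]
  cases h₀ x <;> cases h₁ x <;> simp [Real.sqrt_mul_self]

variable [Finite X] [MeasurableSingletonClass X]

theorem exists_measureReal_eq {s : Set X} {x x' : X} (hx : x ∉ s) (hx' : x' ∈ s) {ε : ℝ}
    (h0 : 0 ≤ ε) (h1 : ε ≤ 1) : ∃ ν : ProbabilityMeasure X, (ν : Measure X).real s = ε := by
  refine ⟨⟨ENNReal.ofReal (1 - ε) • .dirac x + ENNReal.ofReal ε • .dirac x', ⟨?_⟩⟩, ?_⟩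
  · simp [← ENNReal.ofReal_add, h0, h1]
  · simp [Measure.real, Measure.dirac_apply' _ s.toFinite.measurableSet, hx, hx', h0]

variable {XA : Type} [MeasurableSpace XA] {A : LearningProblem XA} {HB : Set (X → Bool)}
  (hHB : ∀ h ∈ HB, Measurable h) {h₀ h₁ : X → Bool}

theorem measure_ne_le_excessRisk_mixture_add (hh₀ : h₀ ∈ HB) (hh₁ : h₁ ∈ HB) (hA : A.hyp = Set.univ)
    (PA : ProbabilityMeasure (XA × Bool)) (ν : ProbabilityMeasure X) (f : XA ⊕ X → Bool) :
    2⁻¹ * (ν : Measure X) {x | h₀ x ≠ h₁ x} ≤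
      excessRisk (mixture PA (labeledBy ν (hHB h₀ hh₀)))
          (mixtureProblem A (realizableProblem HB hHB)).hyp f +
        excessRisk (mixture PA (labeledBy ν (hHB h₁ hh₁)))
          (mixtureProblem A (realizableProblem HB hHB)).hyp f := by
  have hf : f ∘ Sum.inl ∈ A.hyp := hA ▸ Set.mem_univ _
  have hbest {h : X → Bool} (hh : h ∈ HB) :
      bestRisk (labeledBy ν (hHB h hh)) (realizableProblem HB hHB).hyp = 0 :=
    bestRisk_eq_zero hh (risk_labeledBy_self ν _)
  rw [excessRisk_mixture _ _ (hbest hh₀) hf (measurable_of_finite _),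
    excessRisk_mixture _ _ (hbest hh₁) hf (measurable_of_finite _)]
  calc 2⁻¹ * (ν : Measure X) {x | h₀ x ≠ h₁ x}
    _ ≤ 2⁻¹ * (risk (labeledBy ν (hHB h₀ hh₀)) (f ∘ Sum.inr) +
          risk (labeledBy ν (hHB h₁ hh₁)) (f ∘ Sum.inr)) := by
      gcongr
      exact measure_ne_le_risk_add_risk ν _ _ (measurable_of_finite _)
    _ ≤ _ := by
      rw [mul_add]
      gcongr <;> exact le_add_self

theorem ofReal_inv_le_minimaxRisk_mixture [Finite XA] [MeasurableSingletonClass XA]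
    (hA : A.hyp = Set.univ) (hdist : A.dist.Nonempty) (hh₀ : h₀ ∈ HB) (hh₁ : h₁ ∈ HB)
    {x x' : X} (hx : h₀ x = h₁ x) (hx' : h₀ x' ≠ h₁ x') {l : ℕ} (hl : 1 ≤ l) (u : ℕ) :
    ENNReal.ofReal (1 / 32 * (1 / l)) ≤
      (mixtureProblem A (realizableProblem HB hHB)).minimaxRisk l u := by
  cases nonempty_fintype X
  cases nonempty_fintype XA
  obtain ⟨PA, hPA⟩ := hdist
  have hl0 : (0 : ℝ) < l := by exact_mod_cast hl
  have hl1 : (1 : ℝ) / l ≤ 1 := (div_le_one hl0).2 (by exact_mod_cast hl)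
  obtain ⟨ν, hν⟩ := exists_measureReal_eq (s := {x | h₀ x ≠ h₁ x}) (not_not.2 hx) hx'
    (one_div_nonneg.2 hl0.le) hl1
  have hmem {h : X → Bool} (hh : h ∈ HB) : mixture PA (labeledBy ν (hHB h hh)) ∈
      (mixtureProblem A (realizableProblem HB hHB)).dist :=
    mem_mixtureProblem_dist.2 ⟨PA, hPA, _, ⟨h, hh, risk_labeledBy_self ν _⟩, rfl⟩
  refine ofReal_le_minimaxRisk _ (hmem hh₀) (hmem hh₁) ?_ ?_ fun f => ?_
  · have hagree : (ν : Measure X).real {x | h₀ x = h₁ x} = 1 - 1 / l := by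
      rw [← hν, ← probReal_compl_eq_one_sub (Set.toFinite _).measurableSet]
      congr 1
      ext
      simp
    rw [affinity_mixture, affinity_labeledBy, affinity_self, hagree]
    field_simp
    linarith
  · simp only [map_fst_mixture, map_fst_labeledBy]
    rw [← map_fst_labeledBy ν (hHB h₀ hh₀), ← map_fst_mixture, affinity_self, one_pow]
  · refine le_trans ?_ (measure_ne_le_excessRisk_mixture_add hHB hh₀ hh₁ hA PA ν f)
    rw [← ofReal_measureReal, hν, ← ENNReal.ofReal_ofNat 2, ← ENNReal.ofReal_inv_of_pos two_pos,
      ← ENNReal.ofReal_mul (by norm_num)]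
    exact ENNReal.ofReal_le_ofReal (by linarith)

end Realizable

/-! ### The two-point problem -/

section TwoPoint

/-- The mass `m P(Y = y | x)` of `(x, y)` under the distribution in `twoPointProblem` that gives
mass `p` to the first point; here `m` is the mass `p` or `1 - p` of `x`. -/
def twoPointWeight (p : ℝ) (z : Fin 2 × Bool) : ℝ :=
  ![p, 1 - p] z.1 * bif z.2 then ![p, 1 - p] z.1 else 1 - ![p, 1 - p] z.1

variable {P : ProbabilityMeasure (Fin 2 × Bool)}

theorem mem_twoPointProblem_dist_iff_forall :
    P ∈ twoPointProblem.dist ↔ ∀ x, 0 < (P : Measure (Fin 2 × Bool)).real {z | z.1 = x} ∧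
      (P : Measure (Fin 2 × Bool)).real {(x, true)} =
        (P : Measure (Fin 2 × Bool)).real {z | z.1 = x} ^ 2 := by
  refine forall_congr' fun x => ?_
  have hinter : ({z | z.1 = x} ∩ {z | z.2 = true} : Set (Fin 2 × Bool)) = {(x, true)} := by
    ext ⟨x', y⟩
    simp
  have hpos : (P : Measure (Fin 2 × Bool)) {z | z.1 = x} ≠ 0 ↔
      0 < (P : Measure (Fin 2 × Bool)).real {z | z.1 = x} :=
    (measureReal_ne_zero_iff).symm.trans measureReal_nonneg.lt_iff_ne'.symm
  refine (and_congr_left' hpos).trans (and_congr_right fun hx => ?_)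
  rw [cond_apply (Set.toFinite _).measurableSet, hinter,
    ← ENNReal.toReal_eq_toReal_iff' (ENNReal.mul_ne_top
      (ENNReal.inv_ne_top.2 (hpos.2 hx)) (measure_ne_top _ _)) (measure_ne_top _ _),
    ENNReal.toReal_mul, ENNReal.toReal_inv, ← Measure.real, ← Measure.real,
    inv_mul_eq_iff_eq_mul₀ hx.ne', sq]

theorem mem_twoPointProblem_dist : P ∈ twoPointProblem.dist ↔
    ∃ p ∈ Set.Ioo (0 : ℝ) 1, ∀ z, (P : Measure (Fin 2 × Bool)).real {z} = twoPointWeight p z := by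
  rw [mem_twoPointProblem_dist_iff_forall]
  refine ⟨fun h => ?_, fun ⟨p, hp, hP⟩ x => ?_⟩
  · have hsum := sum_measureReal_singleton (μ := (P : Measure (Fin 2 × Bool))) Finset.univ
    simp only [Fintype.sum_prod_type, Fintype.sum_bool, ← real_fst_eq_add, Fin.sum_univ_two,
      Finset.coe_univ, probReal_univ] at hsum
    have hmarginal : ∀ x, (P : Measure (Fin 2 × Bool)).real {z | z.1 = x} =
        ![(P : Measure (Fin 2 × Bool)).real {z | z.1 = 0},
          1 - (P : Measure (Fin 2 × Bool)).real {z | z.1 = 0}] x :=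
      Fin.forall_fin_two.2 ⟨rfl, eq_sub_of_add_eq' hsum⟩
    refine ⟨_, ⟨(h 0).1, by linarith [(h 1).1]⟩, fun ⟨x, y⟩ => ?_⟩
    have hx := real_fst_eq_add P x
    rw [twoPointWeight, ← hmarginal]
    cases y
    · simp only [cond_false]
      linarith [(h x).2]
    · simp [(h x).2, sq]
  · have hmarginal : (P : Measure (Fin 2 × Bool)).real {z | z.1 = x} = ![p, 1 - p] x := by
      simp only [real_fst_eq_add, hP, twoPointWeight, cond_true, cond_false]
      ring
    rw [hmarginal, hP, twoPointWeight, cond_true, sq]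
    fin_cases x <;> simp [hp.1, hp.2]

theorem exists_mem_twoPointProblem_dist {p : ℝ} (hp : p ∈ Set.Ioo (0 : ℝ) 1) :
    ∃ P ∈ twoPointProblem.dist,
      ∀ z, (P : Measure (Fin 2 × Bool)).real {z} = twoPointWeight p z := by
  have hnonneg (z : Fin 2 × Bool) : 0 ≤ twoPointWeight p z := by
    have hmass : ∀ x, ![p, 1 - p] x ∈ Set.Icc (0 : ℝ) 1 := Fin.forall_fin_two.2
      ⟨Set.Ioo_subset_Icc_self hp, sub_nonneg.2 hp.2.le, sub_le_self _ hp.1.le⟩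
    refine mul_nonneg (hmass z.1).1 ?_
    cases z.2
    exacts [sub_nonneg.2 (hmass z.1).2, (hmass z.1).1]
  obtain ⟨P, hP⟩ := exists_real_singleton_eq hnonneg
    (by simp only [Fintype.sum_prod_type, Fintype.sum_bool, Fin.sum_univ_two, twoPointWeight,
      cond_true, cond_false, Matrix.cons_val_zero, Matrix.cons_val_one]; ring)
  exact ⟨P, mem_twoPointProblem_dist.2 ⟨p, hp, hP⟩, hP⟩

theorem affinity_twoPoint {P₀ P₁ : ProbabilityMeasure (Fin 2 × Bool)} {p : ℝ}
    (hp : p ∈ Set.Icc (0 : ℝ) 1)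
    (hP₀ : ∀ z, (P₀ : Measure (Fin 2 × Bool)).real {z} = twoPointWeight p z)
    (hP₁ : ∀ z, (P₁ : Measure (Fin 2 × Bool)).real {z} = twoPointWeight (1 - p) z) :
    affinity (P₀ : Measure (Fin 2 × Bool)) P₁ = 4 * (p * (1 - p)) := by
  have hsqrt (z : Fin 2 × Bool) :
      √(twoPointWeight p z * twoPointWeight (1 - p) z) = p * (1 - p) := by
    rw [← Real.sqrt_sq (mul_nonneg hp.1 (sub_nonneg.2 hp.2))]
    congr 1
    rcases z with ⟨x, y⟩
    fin_cases x <;> cases y <;> simp [twoPointWeight] <;> ring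
  simp [affinity, hP₀, hP₁, hsqrt]

theorem excessRisk_twoPoint {p : ℝ}
    (hP : ∀ z, (P : Measure (Fin 2 × Bool)).real {z} = twoPointWeight p z) (f : Fin 2 → Bool) :
    excessRisk P Set.univ f =
      ENNReal.ofReal (p * bif f 0 then 1 - 2 * p else 2 * p - 1) +
        ENNReal.ofReal ((1 - p) * bif f 1 then 2 * p - 1 else 1 - 2 * p) := by
  rw [excessRisk_univ, Fin.sum_univ_two]
  congr 2
  · cases hf : f 0 <;> simp [hP, twoPointWeight] <;> ring
  · cases hf : f 1 <;> simp [hP, twoPointWeight] <;> ring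

theorem le_excessRisk_twoPoint_add {P₀ P₁ : ProbabilityMeasure (Fin 2 × Bool)} {δ : ℝ}
    (hδ : δ ∈ Set.Icc (0 : ℝ) (1 / 4))
    (hP₀ : ∀ z, (P₀ : Measure (Fin 2 × Bool)).real {z} = twoPointWeight (1 / 2 + δ) z)
    (hP₁ : ∀ z, (P₁ : Measure (Fin 2 × Bool)).real {z} = twoPointWeight (1 - (1 / 2 + δ)) z)
    (f : Fin 2 → Bool) :
    ENNReal.ofReal (δ / 2) ≤ excessRisk P₀ Set.univ f + excessRisk P₁ Set.univ f := by
  obtain ⟨h0, h1⟩ := hδ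
  rw [excessRisk_twoPoint hP₀, excessRisk_twoPoint hP₁]
  cases f 0
  · refine le_add_right (le_add_right (ENNReal.ofReal_le_ofReal ?_))
    simp only [cond_false]
    nlinarith
  · refine le_add_left (le_add_right (ENNReal.ofReal_le_ofReal ?_))
    simp only [cond_true]
    nlinarith

theorem ofReal_inv_sqrt_le_minimaxRisk_mixture {XB : Type} [Finite XB] [MeasurableSpace XB]
    [MeasurableSingletonClass XB] {B : LearningProblem XB} {PB : ProbabilityMeasure (XB × Bool)}
    (hPB : PB ∈ B.dist) (hbest : bestRisk PB B.hyp = 0) {l : ℕ} (hl : 1 ≤ l) :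
    ENNReal.ofReal (1 / 256 * (1 / √l)) ≤ (mixtureProblem twoPointProblem B).minimaxRisk l 0 := by
  cases nonempty_fintype XB
  set δ : ℝ := 1 / (4 * √l) with hδ
  have hsqrt : 1 ≤ √(l : ℝ) := Real.one_le_sqrt.2 (by exact_mod_cast hl)
  have hδ0 : 0 < δ := by positivity
  have hδ1 : δ ≤ 1 / 4 := one_div_le_one_div_of_le (by norm_num) (by linarith)
  obtain ⟨P₀, hP₀mem, hP₀⟩ := exists_mem_twoPointProblem_dist (p := 1 / 2 + δ)
    ⟨by linarith, by linarith⟩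
  obtain ⟨P₁, hP₁mem, hP₁⟩ := exists_mem_twoPointProblem_dist (p := 1 - (1 / 2 + δ))
    ⟨by linarith, by linarith⟩
  refine ofReal_le_minimaxRisk _ (mem_mixtureProblem_dist.2 ⟨P₀, hP₀mem, PB, hPB, rfl⟩)
    (mem_mixtureProblem_dist.2 ⟨P₁, hP₁mem, PB, hPB, rfl⟩) ?_ (pow_zero _) fun f => ?_
  · have hlδ : l * δ ^ 2 = 1 / 16 := by
      rw [hδ, div_pow, mul_pow, Real.sq_sqrt (Nat.cast_nonneg l)]
      field_simp
      norm_num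
    rw [affinity_mixture, affinity_self, affinity_twoPoint ⟨by linarith, by linarith⟩ hP₀ hP₁]
    linarith
  · have hfA : f ∘ Sum.inl ∈ twoPointProblem.hyp := Set.mem_univ _
    have hfB : Measurable (f ∘ Sum.inr) := measurable_of_finite _
    rw [excessRisk_mixture _ _ hbest hfA hfB, excessRisk_mixture _ _ hbest hfA hfB]
    calc ENNReal.ofReal (16 * (1 / 256 * (1 / √l)))
      _ = 2⁻¹ * ENNReal.ofReal (δ / 2) := by
        rw [← ENNReal.ofReal_ofNat 2, ← ENNReal.ofReal_inv_of_pos two_pos,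
          ← ENNReal.ofReal_mul (by norm_num), hδ]
        congr 1
        field_simp
        norm_num
      _ ≤ 2⁻¹ * (excessRisk P₀ twoPointProblem.hyp (f ∘ Sum.inl) +
            excessRisk P₁ twoPointProblem.hyp (f ∘ Sum.inl)) := by
        gcongr
        exact le_excessRisk_twoPoint_add ⟨hδ0.le, hδ1⟩ hP₀ hP₁ _
      _ ≤ _ := by
        rw [mul_add]
        gcongr <;> exact le_self_add

end TwoPoint

/-! ### The plug-in learner -/

section PlugIn

variable {XB : Type}

/-- The function on `X_A ∪ X_B` with value `1` at `x₁`, `-1` at `x₂` and `0` on `X_B`. Under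
`½ P_A + ½ P_B` its mean is half of `P_A(x₁) - P_A(x₂)`, the sign of which determines the Bayes
classifier of `P_A`. -/
def contrast : Fin 2 ⊕ XB → ℝ := Sum.elim ![1, -1] 0

theorem abs_contrast_le_one (x : Fin 2 ⊕ XB) : |contrast x| ≤ 1 := by
  rcases x with x | x
  · fin_cases x <;> simp [contrast]
  · simp [contrast]

theorem excessRisk_twoPoint_sign_le {P : ProbabilityMeasure (Fin 2 × Bool)} {p : ℝ}
    (hp : p ∈ Set.Icc (0 : ℝ) 1)
    (hP : ∀ z, (P : Measure (Fin 2 × Bool)).real {z} = twoPointWeight p z) (t : ℝ) :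
    excessRisk P Set.univ ![decide (0 < t), !decide (0 < t)] ≤
      2 * ENNReal.ofReal |t - (p - 1 / 2)| := by
  have hsplit (e : ℝ) : ENNReal.ofReal (p * e) + ENNReal.ofReal ((1 - p) * e) =
      ENNReal.ofReal e := by
    rw [ENNReal.ofReal_mul hp.1, ENNReal.ofReal_mul (sub_nonneg.2 hp.2), ← add_mul,
      ← ENNReal.ofReal_add hp.1 (sub_nonneg.2 hp.2), add_sub_cancel, ENNReal.ofReal_one, one_mul]
  rw [excessRisk_twoPoint hP, ← ENNReal.ofReal_ofNat 2, ← ENNReal.ofReal_mul zero_le_two]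
  simp only [Matrix.cons_val_zero, Matrix.cons_val_one]
  by_cases ht : 0 < t
  · simp only [ht, decide_true, Bool.not_true, cond_true, cond_false, hsplit]
    exact ENNReal.ofReal_le_ofReal (by linarith [le_abs_self (t - (p - 1 / 2))])
  · simp only [ht, decide_false, Bool.not_false, cond_true, cond_false, hsplit]
    exact ENNReal.ofReal_le_ofReal (by linarith [neg_le_abs (t - (p - 1 / 2))])

variable [Finite XB] [MeasurableSpace XB] [MeasurableSingletonClass XB]

theorem integral_contrast_mixture {PA : ProbabilityMeasure (Fin 2 × Bool)} {p : ℝ}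
    (hPA : ∀ z, (PA : Measure (Fin 2 × Bool)).real {z} = twoPointWeight p z)
    (PB : ProbabilityMeasure (XB × Bool)) :
    ∫ z, contrast z.1 ∂(mixture PA PB : Measure ((Fin 2 ⊕ XB) × Bool)) = p - 1 / 2 := by
  cases nonempty_fintype XB
  have hinl (x : Fin 2) (y : Bool) :
      (mixture PA PB : Measure ((Fin 2 ⊕ XB) × Bool)).real {(.inl x, y)} =
        twoPointWeight p (x, y) / 2 := by
    rw [Measure.real, mixture_singleton_inl, ENNReal.toReal_mul, ENNReal.toReal_inv,
      ENNReal.toReal_ofNat, ← hPA, Measure.real, div_eq_inv_mul]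
  rw [integral_fintype .of_finite]
  simp only [Fintype.sum_prod_type, Fintype.sum_sum_type, Fintype.sum_bool, Fin.sum_univ_two, hinl,
    twoPointWeight, contrast, Sum.elim_inl, Sum.elim_inr, Pi.zero_apply, smul_eq_mul, mul_zero,
    add_zero, Finset.sum_const_zero, Matrix.cons_val_zero, Matrix.cons_val_one, cond_true,
    cond_false]
  ring

open Classical in
/-- The learner that uses the sign of an estimate `T` of the mean of `contrast` to classify the
points of `X_A`, and memorizes the points of `X_B` seen with label `1`. -/
def plugInLearner {l u : ℕ} (T : Sample (Fin 2 ⊕ XB) l u → ℝ) : Learner (Fin 2 ⊕ XB) l u where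
  toFun S := Sum.elim ![decide (0 < T S), !decide (0 < T S)]
    fun x => decide (∃ i, S.1 i = (.inr x, true))
  measurable_toFun := measurable_of_finite _

variable {HB : Set (XB → Bool)} {hHB : ∀ h ∈ HB, Measurable h} {l u : ℕ}

open Classical in
theorem lintegral_risk_memorize_le (PA : ProbabilityMeasure (Fin 2 × Bool))
    {PB : ProbabilityMeasure (XB × Bool)} {h : XB → Bool} (hh : risk PB h = 0) (hl : 1 ≤ l)
    (u : ℕ) :
    ∫⁻ S, 2⁻¹ * risk PB (fun x => decide (∃ i, S.1 i = (.inr x, true)))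
      ∂(sampleMeasure (mixture PA PB) l u) ≤ ENNReal.ofReal (Nat.card XB * (1 / l)) := by
  cases nonempty_fintype XB
  have : Nonempty (Fin l) := ⟨⟨0, hl⟩⟩
  rw [risk_eq_sum, Finset.sum_eq_zero_iff] at hh
  have hpoint (x : XB) :
      ∫⁻ S, (mixture PA PB : Measure ((Fin 2 ⊕ XB) × Bool))
          {(.inr x, !decide (∃ i, S.1 i = (.inr x, true)))} ∂(sampleMeasure (mixture PA PB) l u) ≤
        ENNReal.ofReal (1 / l) := by
    have hrealizable : (mixture PA PB : Measure ((Fin 2 ⊕ XB) × Bool)) {(.inr x, true)} = 0 ∨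
        (mixture PA PB : Measure ((Fin 2 ⊕ XB) × Bool)) {(.inr x, false)} = 0 := by
      have hx := hh x (Finset.mem_univ x)
      rw [mixture_singleton_inr, mixture_singleton_inr]
      cases hlabel : h x <;> simp_all
    have hmemorize := lintegral_measure_not_seen_le (ι := Fin l) hrealizable
    rw [Fintype.card_fin] at hmemorize
    exact (lintegral_sampleMeasure_fst _ u (measurable_of_finite _)).trans_le hmemorize
  simp only [risk_eq_sum, Finset.mul_sum, ← mixture_singleton_inr PA PB]
  rw [lintegral_finsetSum _ fun x _ => measurable_of_finite _]
  refine (Finset.sum_le_sum fun x _ => hpoint x).trans_eq ?_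
  rw [Finset.sum_const, Finset.card_univ, ENNReal.ofReal_mul (Nat.cast_nonneg _),
    ENNReal.ofReal_natCast, nsmul_eq_mul, Nat.card_eq_fintype_card]

theorem expectedExcessRisk_plugInLearner_le {T : Sample (Fin 2 ⊕ XB) l u → ℝ}
    {PA : ProbabilityMeasure (Fin 2 × Bool)} (hPA : PA ∈ twoPointProblem.dist)
    {PB : ProbabilityMeasure (XB × Bool)} (hPB : PB ∈ (realizableProblem HB hHB).dist)
    (hl : 1 ≤ l) :
    expectedExcessRisk (plugInLearner T)
        (mixtureProblem twoPointProblem (realizableProblem HB hHB)).hyp (mixture PA PB) ≤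
      ∫⁻ S, ENNReal.ofReal
          |T S - ∫ z, contrast z.1 ∂(mixture PA PB : Measure ((Fin 2 ⊕ XB) × Bool))|
        ∂(sampleMeasure (mixture PA PB) l u) + ENNReal.ofReal (Nat.card XB * (1 / l)) := by
  classical
  obtain ⟨p, hp, hPA⟩ := mem_twoPointProblem_dist.1 hPA
  obtain ⟨h, hh, hrisk⟩ := hPB
  rw [integral_contrast_mixture hPA]
  have hpointwise (S : Sample (Fin 2 ⊕ XB) l u) :
      excessRisk (mixture PA PB) (mixtureProblem twoPointProblem (realizableProblem HB hHB)).hyp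
        ((plugInLearner T).toFun S) ≤ ENNReal.ofReal |T S - (p - 1 / 2)| +
          2⁻¹ * risk PB (fun x => decide (∃ i, S.1 i = (.inr x, true))) := by
    rw [excessRisk_mixture PA PB (bestRisk_eq_zero hh hrisk) (Set.mem_univ _)
      (measurable_of_finite _)]
    gcongr
    · refine (ENNReal.inv_mul_le_iff two_ne_zero ENNReal.ofNat_ne_top).2 ?_
      exact excessRisk_twoPoint_sign_le (Set.Ioo_subset_Icc_self hp) hPA (T S)
    · rfl
  refine (lintegral_mono hpointwise).trans ?_
  rw [lintegral_add_left (measurable_of_finite _)]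
  gcongr
  exact lintegral_risk_memorize_le PA hrisk hl u

theorem minimaxRisk_mixture_le_of_estimator (T : Sample (Fin 2 ⊕ XB) l u → ℝ) {r : ℝ} (hr : 0 ≤ r)
    (hT : ∀ P : ProbabilityMeasure ((Fin 2 ⊕ XB) × Bool),
      ∫⁻ S, ENNReal.ofReal |T S - ∫ z, contrast z.1 ∂(P : Measure ((Fin 2 ⊕ XB) × Bool))|
        ∂(sampleMeasure P l u) ≤ ENNReal.ofReal r) (hl : 1 ≤ l) :
    (mixtureProblem twoPointProblem (realizableProblem HB hHB)).minimaxRisk l u ≤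
      ENNReal.ofReal (r + Nat.card XB * (1 / l)) := by
  refine iInf_le_of_le (plugInLearner T) (iSup₂_le fun P hP => ?_)
  obtain ⟨PA, hPA, PB, hPB, rfl⟩ := mem_mixtureProblem_dist.1 hP
  refine (expectedExcessRisk_plugInLearner_le hPA hPB hl).trans ?_
  rw [ENNReal.ofReal_add hr (by positivity)]
  gcongr
  exact hT _

theorem minimaxRisk_mixture_le_inv_sqrt (hl : 1 ≤ l) :
    (mixtureProblem twoPointProblem (realizableProblem HB hHB)).minimaxRisk l u ≤
      ENNReal.ofReal ((1 + Nat.card XB) * (1 / √l)) := by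
  have : Nonempty (Fin l) := ⟨⟨0, hl⟩⟩
  refine (minimaxRisk_mixture_le_of_estimator (fun S => (∑ i, contrast (S.1 i).1) / l)
    (r := 1 / √l) (by positivity) (fun P => ?_) hl).trans (ENNReal.ofReal_le_ofReal ?_)
  · have hmean := lintegral_abs_empiricalMean_sub_le (ι := Fin l)
      (μ := (P : Measure ((Fin 2 ⊕ XB) × Bool))) (g := fun z => contrast z.1)
      (measurable_of_finite _) fun z => abs_contrast_le_one z.1
    rw [Fintype.card_fin] at hmean
    exact (lintegral_sampleMeasure_fst P u (measurable_of_finite _)).trans_le hmean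
  · have hsqrt : √(l : ℝ) ≤ l := Real.sqrt_le_self_iff.2 (.inr (by exact_mod_cast hl))
    rw [one_add_mul]
    gcongr

theorem minimaxRisk_mixture_le_inv (hl : 1 ≤ l) (hu : l ^ 2 ≤ u) :
    (mixtureProblem twoPointProblem (realizableProblem HB hHB)).minimaxRisk l u ≤
      ENNReal.ofReal ((1 + Nat.card XB) * (1 / l)) := by
  have : Nonempty (Fin u) := ⟨⟨0, (pow_pos hl 2).trans_le hu⟩⟩
  rw [one_add_mul]
  refine minimaxRisk_mixture_le_of_estimator (fun S => (∑ i, contrast (S.2 i)) / u)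
    (by positivity) (fun P => ?_) hl
  have hmean := lintegral_abs_empiricalMean_sub_le (ι := Fin u)
    (μ := (P : Measure ((Fin 2 ⊕ XB) × Bool)).map Prod.fst) (g := contrast)
    (measurable_of_finite _) abs_contrast_le_one
  rw [Fintype.card_fin,
    integral_map measurable_fst.aemeasurable (measurable_of_finite _).aestronglyMeasurable] at hmean
  have hsqrt : (l : ℝ) ≤ √u := Real.le_sqrt_of_sq_le (by exact_mod_cast hu)
  refine ((lintegral_sampleMeasure_snd P l (measurable_of_finite _)).trans_le hmean).trans ?_
  gcongr

end PlugIn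

theorem mainTheorem1_general {XB : Type} [Finite XB] [MeasurableSpace XB]
    [MeasurableSingletonClass XB] {HB : Set (XB → Bool)} (hHB : ∀ h ∈ HB, Measurable h)
    {h₀ h₁ : XB → Bool} (hh₀ : h₀ ∈ HB) (hh₁ : h₁ ∈ HB) {x x' : XB} (hx : h₀ x = h₁ x)
    (hx' : h₀ x' ≠ h₁ x') :
    let Q := mixtureProblem twoPointProblem (realizableProblem HB hHB)
    HasFiniteVCDim Q.hyp ∧
      HasRate (fun l => Q.minimaxRisk l 0) (fun l => 1 / √l) ∧
      (∀ u : ℕ → ℕ, (∀ l, l ^ 2 ≤ u l) →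
        HasRate (fun l => Q.minimaxRisk l (u l)) (fun l => 1 / (l : ℝ))) ∧
      ∃ c : ℝ, 0 < c ∧ ∀ u : ℕ → ℕ, ∀ l : ℕ, 1 ≤ l →
        ENNReal.ofReal (c * (1 / (l : ℝ))) ≤ Q.minimaxRisk l (u l) := by
  intro Q
  have hdist : twoPointProblem.dist.Nonempty := by
    obtain ⟨PA, hPA, -⟩ := exists_mem_twoPointProblem_dist (p := 1 / 2) ⟨by norm_num, by norm_num⟩
    exact ⟨PA, hPA⟩
  have hlower {l : ℕ} (hl : 1 ≤ l) (u : ℕ) :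
      ENNReal.ofReal (1 / 32 * (1 / l)) ≤ Q.minimaxRisk l u :=
    ofReal_inv_le_minimaxRisk_mixture hHB rfl hdist hh₀ hh₁ hx hx' hl u
  have hlowerSupervised {l : ℕ} (hl : 1 ≤ l) :
      ENNReal.ofReal (1 / 256 * (1 / √l)) ≤ Q.minimaxRisk l 0 := by
    have hrisk := risk_labeledBy_self ⟨.dirac x, inferInstance⟩ (hHB h₀ hh₀)
    exact ofReal_inv_sqrt_le_minimaxRisk_mixture (B := realizableProblem HB hHB)
      ⟨h₀, hh₀, hrisk⟩ (bestRisk_eq_zero hh₀ hrisk) hl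
  exact ⟨hasFiniteVCDim_of_finite _,
    ⟨1 / 256, 1 + Nat.card XB, by norm_num, by positivity, fun l hl =>
      ⟨hlowerSupervised hl, minimaxRisk_mixture_le_inv_sqrt hl⟩⟩,
    fun u hu => ⟨1 / 32, 1 + Nat.card XB, by norm_num, by positivity, fun l hl =>
      ⟨hlower hl (u l), minimaxRisk_mixture_le_inv hl (hu l)⟩⟩,
    1 / 32, by norm_num, fun u l hl => hlower hl (u l)⟩

end

end SSL

theorem mainTheorem1 :
    ∃ (XB : Type) (_ : MeasurableSpace XB) (_ : MeasurableSingletonClass XB)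
      (HB : Set (XB → Bool)) (hHB : ∀ h ∈ HB, Measurable h)
      (Q : SSL.LearningProblem (Fin 2 ⊕ XB)),
      SSL.HasFiniteVCDim HB ∧
      Q = SSL.mixtureProblem SSL.twoPointProblem (SSL.realizableProblem HB hHB) ∧
      SSL.HasFiniteVCDim Q.hyp ∧
      SSL.HasRate (fun l => Q.minimaxRisk l 0) (fun l => 1 / Real.sqrt l) ∧
      (∀ u : ℕ → ℕ, (∀ l, l ^ 2 ≤ u l) →
        SSL.HasRate (fun l => Q.minimaxRisk l (u l)) (fun l => 1 / (l : ℝ))) ∧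
      (∃ c : ℝ, 0 < c ∧ ∀ u : ℕ → ℕ, ∀ l : ℕ, 1 ≤ l →
        ENNReal.ofReal (c * (1 / (l : ℝ))) ≤ Q.minimaxRisk l (u l)) :=
  ⟨Fin 2, inferInstance, inferInstance, Set.univ, fun _ _ => measurable_of_finite _, _,
    SSL.hasFiniteVCDim_of_finite _, rfl,
    SSL.mainTheorem1_general (fun _ _ => measurable_of_finite _) (h₀ := ![false, false])
      (h₁ := ![false, true]) (Set.mem_univ _) (Set.mem_univ _) (x := 0) (x' := 1) rfl (by simp)⟩
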